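/- **The game.** Let $\Gamma$ be a connected (simple) graph with path metric $d$, and let $n\in\mathbb N$. In the game of Weak Cops and Robbers with $n$ cops on $\Gamma$, the cops first choose positive integers $\sigma$ (speed) and $\rho$ (reach); knowing these, the robber chooses positive integers $\psi$ (speed) and $R$ (radius) and a vertex $v$ of $\Gamma$. Then each cop chooses an initial vertex, and, knowing these, the robber chooses his initial vertex. They move in alternating turns with full information, starting with the cops. On the cops' turn each cop moves to a vertex at distance at most $\sigma$ from its current position; the robber is captured if afterwards some cop is within distance $\rho$ of him. If he is not captured, the robber moves from his current vertex $x$ to a vertex $y$ with $d(x,y)\le\psi$ such that some path from $x$ to $y$ contains no vertex within distance $\rho$ of a cop. The cops win if the robber is captured at some time, or if from some turn on the robber is never within distance $R$ of $v$. The graph $\Gamma$ is *$n$-weak cop win* if there are $\sigma,\rho$ such that for all $\psi,R$ and all $v$ the cops have a winning strategy. The weak cop number $\mathrm{wCop}(\Gamma)$ is the smallest $n$ for which $\Gamma$ is $n$-weak cop win, and $\mathrm{wCop}(\Gamma)=\infty$ if there is no such $n$. **Groups.** The Cayley graph $\mathrm{Cay}(K,S)$ of a group $K$ with respect to a generating set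 $S$ has vertex set $K$ and an edge between $k$ and $ks$ for all $k\in K$ and $s\in S$ with $s\neq 1$. A finitely generated group $K$ has infinite weak cop number if $\mathrm{wCop}(\mathrm{Cay}(K,S))=\infty$ for every finite generating set $S$ of $K$. The restricted wreath product $G\wr H$ of groups is the set of pairs $(f,h)$ with $h\in H$ and $f\colon H\to G$ satisfying $f(x)=1$ for all but finitely many $x$, with the product $(f,h)(f',h')=(x\mapsto f(x)\,f'(h^{-1}x),\ hh')$. **Theorem.** Let $G$ and $H$ be finitely generated groups with $G$ nontrivial and $H$ infinite. Then the restricted wreath product $G\wr H$ is finitely generated and has infinite weak cop number. In particular, the lamplighter groups $\mathbb Z_m\wr\mathbb Z$, $m\ge 2$, have infinite weak cop number. -/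

import Mathlib

/-! ### The game of Weak Cops and Robbers -/

namespace WeakCops

universe u

variable {V : Type u}

/-- A strategy for `n` cops of speed `σ` on `Γ`. It prescribes the positions of the cops as a
function of the list of all positions the robber has occupied so far, latest first:
`pos []` are the initial positions, chosen before the robber appears on the graph, and
`pos (x :: h)` are the positions to which the cops move when the robber, after the past `h`, is
at `x`. (Earlier positions of the cops are determined by the strategy and the robber's past,
so this is a strategy with full information.) -/
structure CopStrategy (Γ : SimpleGraph V) (n σ : ℕ) where
  /-- The positions of the cops after the given past of the robber. -/
  pos : List V → Fin n → V
  /-- Each cop moves to a vertex at distance at most `σ` from its current position. -/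
  legal : ∀ (h : List V) (x : V) (i : Fin n), Γ.edist (pos h i) (pos (x :: h) i) ≤ σ

/-- The list `[r (t - 1), …, r 1, r 0]` of the first `t` positions of the robber. -/
def robberPast (r : ℕ → V) : ℕ → List V
  | 0 => []
  | t + 1 => r t :: robberPast r t

/-- The positions of the cops after `t` turns of theirs, when they follow the strategy `S` and
the robber's successive positions are `r 0, r 1, …`. -/
def CopStrategy.play {Γ : SimpleGraph V} {n σ : ℕ} (S : CopStrategy Γ n σ) (r : ℕ → V)
    (t : ℕ) : Fin n → V :=
  S.pos (robberPast r t)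

/-- The vertex `x` is within the reach `ρ` of one of the cops, who are at `c`. -/
def InReach (Γ : SimpleGraph V) {n : ℕ} (ρ : ℕ) (c : Fin n → V) (x : V) : Prop :=
  ∃ i, Γ.edist (c i) x ≤ ρ

/-- A legal move of the robber from `x` to `y` while the cops are at `c`: the vertex `y` is at
distance at most `ψ` from `x`, and there is a path from `x` to `y` none of whose vertices is
within distance `ρ` of a cop. -/
def RobberMove (Γ : SimpleGraph V) {n : ℕ} (ρ ψ : ℕ) (c : Fin n → V) (x y : V) : Prop :=
  Γ.edist x y ≤ ψ ∧ ∃ p : Γ.Walk x y, ∀ z ∈ p.support, ¬ InReach Γ ρ c z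

/-- The robber is captured in the round `t`: after the cops' move in this round he is within reach
of a cop. In the round `t` the cops move from `S.play r t` to `S.play r (t + 1)`, while the robber
is at `r t`; then the robber, if not captured, moves from `r t` to `r (t + 1)`. -/
def CopStrategy.Captures {Γ : SimpleGraph V} {n σ : ℕ} (S : CopStrategy Γ n σ) (ρ : ℕ)
    (r : ℕ → V) (t : ℕ) : Prop :=
  InReach Γ ρ (S.play r (t + 1)) (r t)

/-- The strategy `S` of the cops, with reach `ρ`, eventually protects the ball of radius `R` about
`v` from a robber of speed `ψ`: however the robber chooses his initial vertex and his moves, all of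
them legal as long as he has not been captured, either he is captured in some round, or from
some round on he is never within distance `R` of `v`. (The terms `r t` after a capture play
no role.) -/
def CopStrategy.Protects {Γ : SimpleGraph V} {n σ : ℕ} (S : CopStrategy Γ n σ) (ρ ψ R : ℕ)
    (v : V) : Prop :=
  ∀ r : ℕ → V,
    (∀ t, (∀ s ≤ t, ¬ S.Captures ρ r s) →
      RobberMove Γ ρ ψ (S.play r (t + 1)) (r t) (r (t + 1))) →
    (∃ t, S.Captures ρ r t) ∨ ∃ T, ∀ t, T ≤ t → ¬ Γ.edist v (r t) ≤ R

/-- `Γ` is `CopWin (n, σ, ρ, ψ, R)`: for every vertex `v`, `n` cops with speed `σ` and reach `ρ`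
can eventually protect the ball of radius `R` about `v` from a robber of speed `ψ`. -/
def CopWin (Γ : SimpleGraph V) (n σ ρ ψ R : ℕ) : Prop :=
  ∀ v : V, ∃ S : CopStrategy Γ n σ, S.Protects ρ ψ R v

/-- `Γ` is `n`-weak cop win. All the parameters are positive integers. -/
def IsWeakCopWin (Γ : SimpleGraph V) (n : ℕ) : Prop :=
  ∃ σ ρ : ℕ, 0 < σ ∧ 0 < ρ ∧ ∀ ψ R : ℕ, 0 < ψ → 0 < R → CopWin Γ n σ ρ ψ R

/-- The weak cop number of `Γ`: the least `n` for which `Γ` is `n`-weak cop win, and `∞` (that is,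
`⊤`) if there is no such `n`. -/
noncomputable def weakCopNumber (Γ : SimpleGraph V) : ℕ∞ :=
  ⨅ (n : ℕ) (_ : IsWeakCopWin Γ n), (n : ℕ∞)

/-- The group `K` has infinite weak cop number: `K` is finitely generated, and the weak cop number
of its Cayley graph with respect to each finite generating set is infinite. -/
def GroupHasInfiniteWeakCopNumber (K : Type u) [Group K] : Prop :=
  Group.FG K ∧ ∀ S : Set K, S.Finite → Subgroup.closure S = ⊤ →
    weakCopNumber (SimpleGraph.mulCayley S) = ⊤

end WeakCops

/-- The restricted wreath product `G ≀ H`: the pairs `(g, h)` with `g : H → G` of finite support and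
`h ∈ H`, under `(g, h) (g', h') = (x ↦ g x * g' (h⁻¹ * x), h * h')`. It is the subgroup of the
unrestricted wreath product given by the condition of finite support. -/
def RestrictedWreathProduct (G H : Type*) [Group G] [Group H] :
    Subgroup (RegularWreathProduct G H) where
  carrier := {x | (Function.mulSupport x.left).Finite}
  one_mem' := by simp
  mul_mem' := by
    intro a b ha hb
    have hb' : (Function.mulSupport fun x ↦ b.left (a.right⁻¹ * x)).Finite :=
      Set.Finite.preimage (f := fun x ↦ a.right⁻¹ * x) (mul_right_injective _).injOn hb
    exact (Set.Finite.union ha hb').subset (Function.mulSupport_mul _ _)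
  inv_mem' := by
    intro a ha
    have h : (Function.mulSupport fun x ↦ a.left (a.right * x)).Finite :=
      Set.Finite.preimage (f := fun x ↦ a.right * x) (mul_right_injective _).injOn ha
    refine h.subset fun x hx ↦ ?_
    simpa using hx

/-! The robber hides in one of many sets `K i`, any two of them linked within their union. If every
ball of a given radius meets boundedly many, some set among a fixed finite number is far from all
cops. Before each cop move he sits in such a set; afterwards it is still out of reach, and he passes
through it to a new free set (`not_isWeakCopWin_of_joined_sets`). In the wreath product, take
disjoint sequences `e`, `e'` in `H`. `K i` is a neighbourhood of the configurations whose lamps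
along `e`, or along `e'`, are lit exactly at index `i`. To pass from `i` to `j`, change the
`e'`-lamp while the `e`-lamp pins `i`, then the `e`-lamp while the `e'`-lamp pins `j`. -/

namespace WeakCops

/-- If a graph contains a sequence of pairwise joined sets `K i`, of which each ball of radius `r`
meets only boundedly many, then the robber evades any number of cops without ever leaving
a bounded region: he always stays in some `K i` that is far from all cops. -/
theorem not_isWeakCopWin_of_joined_sets {V : Type*} {Γ : SimpleGraph V} (p : ℕ → V)
    (K : ℕ → Set V)
    (hwalk : ∀ i j, ∃ w : Γ.Walk (p i) (p j), ∀ z ∈ w.support, z ∈ K i ∪ K j)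
    (hK : ∀ r : ℕ, ∃ k : ℕ, ∀ v, ∃ s : Finset ℕ, s.card ≤ k ∧
      ∀ i, ∀ x ∈ K i, Γ.edist v x ≤ r → i ∈ s) (n : ℕ) :
    ¬ IsWeakCopWin Γ n := by
  rintro ⟨σ, ρ, -, -, hwin⟩
  have hpK : ∀ i, p i ∈ K i := fun i ↦ by
    obtain ⟨w, hw⟩ := hwalk i i
    simpa using hw _ w.start_mem_support
  obtain ⟨k, hk⟩ := hK (σ + ρ)
  choose s hsk hs using hk
  -- Pigeonhole: `n` balls of radius `σ + ρ` meet at most `n * k` of the sets.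
  set N := n * k + 1
  have hfree : ∀ c : Fin n → V, ∃ i < N, ∀ x ∈ K i, ∀ a, ¬ Γ.edist (c a) x ≤ (σ + ρ : ℕ) := by
    intro c
    by_contra! hcon
    have hsub : Finset.range N ⊆ Finset.univ.biUnion fun a ↦ s (c a) := by
      intro i hi
      obtain ⟨x, hx, a, ha⟩ := hcon i (Finset.mem_range.1 hi)
      exact Finset.mem_biUnion.2 ⟨a, Finset.mem_univ a, hs _ _ x hx ha⟩
    have h1 := Finset.card_le_card hsub
    have h2 := Finset.card_biUnion_le_card_mul Finset.univ (fun a ↦ s (c a)) k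
      fun a _ ↦ hsk (c a)
    simp only [Finset.card_range, Finset.card_univ, Fintype.card_fin] at h1 h2
    omega
  choose free hfreeN hfree using hfree
  -- `M` depends only on `n`, `σ`, `ρ`, so the robber may use it for his speed and radius; `M + 1`
  -- makes these positive.
  obtain ⟨M, hM⟩ : ∃ M : ℕ, ∀ i < N, ∀ j < N, Γ.edist (p i) (p j) ≤ M := by
    refine ⟨(Finset.range N ×ˢ Finset.range N).sup fun q ↦ Γ.dist (p q.1) (p q.2),
      fun i hi j hj ↦ ?_⟩
    obtain ⟨w, -⟩ := hwalk i j
    rw [← w.reachable.coe_dist_eq_edist, Nat.cast_le]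
    exact Finset.le_sup (f := fun q : ℕ × ℕ ↦ Γ.dist (p q.1) (p q.2)) (b := (i, j))
      (by simp [hi, hj])
  obtain ⟨S, hS⟩ := hwin (M + 1) (M + 1) M.succ_pos M.succ_pos (p 0)
  have hMM : ∀ i < N, ∀ j < N, Γ.edist (p i) (p j) ≤ (M + 1 : ℕ) := fun i hi j hj ↦
    (hM i hi j hj).trans (by exact_mod_cast M.le_succ)
  -- The robber answers the cops' current positions, themselves determined by his past; hence
  -- recursion on the past.
  let past : ℕ → List V := fun t ↦ Nat.rec [] (fun _ l ↦ p (free (S.pos l)) :: l) t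
  let r : ℕ → V := fun t ↦ p (free (S.pos (past t)))
  have hpast : ∀ t, robberPast r t = past t := by
    intro t
    induction t with
    | zero => rfl
    | succ t ih => rw [robberPast, ih]
  have hplay : ∀ t, S.play r t = S.pos (past t) := fun t ↦ by rw [CopStrategy.play, hpast]
  have hsafe : ∀ t, ∀ z ∈ K (free (S.pos (past t))), ¬ InReach Γ ρ (S.play r (t + 1)) z := by
    rintro t z hz ⟨a, ha⟩
    refine hfree (S.pos (past t)) z hz a ?_
    rw [hplay] at ha
    push_cast
    exact Γ.edist_triangle.trans (add_le_add (S.legal (past t) _ a) ha)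
  have hmove : ∀ t, RobberMove Γ ρ (M + 1) (S.play r (t + 1)) (r t) (r (t + 1)) := by
    intro t
    obtain ⟨w, hw⟩ := hwalk (free (S.pos (past t))) (free (S.pos (past (t + 1))))
    refine ⟨hMM _ (hfreeN _) _ (hfreeN _), w, fun z hz ↦ (hw z hz).elim (hsafe t z) ?_⟩
    rintro hz ⟨a, ha⟩
    rw [hplay] at ha
    exact hfree _ z hz a (ha.trans (by exact_mod_cast Nat.le_add_left _ _))
  rcases hS r fun t _ ↦ hmove t with ⟨t, ht⟩ | ⟨T, hT⟩
  · exact hsafe t _ (hpK _) ht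
  · exact hT T le_rfl (hMM 0 (Nat.succ_pos _) _ (hfreeN _))

end WeakCops

/-! ### Walks near a set, and balls in Cayley graphs -/

namespace SimpleGraph

/-- The vertices `x` and `y` are joined by a walk that stays within distance `L` of `A`. -/
def JoinedNear {V : Type*} (Γ : SimpleGraph V) (L : ℕ) (A : Set V) (x y : V) : Prop :=
  ∃ w : Γ.Walk x y, ∀ z ∈ w.support, ∃ a ∈ A, Γ.edist a z ≤ L

namespace JoinedNear

variable {V : Type*} {Γ : SimpleGraph V} {L : ℕ} {A B : Set V} {x y z : V}

theorem refl (hx : x ∈ A) : Γ.JoinedNear L A x x :=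
  ⟨.nil, fun z hz ↦ ⟨x, hx, by simp_all⟩⟩

theorem symm (h : Γ.JoinedNear L A x y) : Γ.JoinedNear L A y x := by
  obtain ⟨w, hw⟩ := h
  exact ⟨w.reverse, fun z hz ↦ hw z (by simpa using hz)⟩

theorem trans (h : Γ.JoinedNear L A x y) (h' : Γ.JoinedNear L A y z) : Γ.JoinedNear L A x z := by
  obtain ⟨w, hw⟩ := h
  obtain ⟨w', hw'⟩ := h'
  exact ⟨w.append w', fun z hz ↦ ((Walk.mem_support_append_iff _ _).1 hz).elim (hw z) (hw' z)⟩

theorem mono (hAB : A ⊆ B) (h : Γ.JoinedNear L A x y) : Γ.JoinedNear L B x y := by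
  obtain ⟨w, hw⟩ := h
  exact ⟨w, fun z hz ↦ (hw z hz).imp fun a ha ↦ ⟨hAB ha.1, ha.2⟩⟩

theorem of_edist_le (hx : x ∈ A) (h : Γ.edist x y ≤ L) : Γ.JoinedNear L A x y := by
  obtain ⟨w, hw⟩ := exists_walk_of_edist_ne_top (ne_top_of_le_ne_top (ENat.natCast_ne_top L) h)
  refine ⟨w, fun z hz ↦ ⟨x, hx, ?_⟩⟩
  classical
  refine le_trans (edist_le (w.takeUntil z hz)) (le_trans ?_ (hw.le.trans h))
  exact_mod_cast w.length_takeUntil_le_length hz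

end JoinedNear

section mulCayley

open scoped Pointwise

variable {K : Type*} [Group K] {S : Set K}

theorem exists_edist_mulCayley_mul_le {k : K} (hk : k ∈ Subgroup.closure S) :
    ∃ L : ℕ, ∀ x, (mulCayley S).edist x (x * k) ≤ L := by
  induction hk using Subgroup.closure_induction with
  | mem k hk =>
    refine ⟨1, fun x ↦ ?_⟩
    rw [Nat.cast_one, edist_le_one_iff_adj_or_eq, mulCayley_adj']
    by_cases h : x = x * k
    · exact .inr h
    · exact .inl ⟨h, k, hk, .inl rfl⟩
  | one => exact ⟨0, by simp⟩
  | mul k l _ _ hk hl =>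
    obtain ⟨L, hL⟩ := hk
    obtain ⟨M, hM⟩ := hl
    refine ⟨L + M, fun x ↦ ?_⟩
    push_cast
    refine (mulCayley S).edist_triangle.trans (add_le_add (hL x) ?_)
    rw [← mul_assoc]
    exact hM _
  | inv k _ hk =>
    obtain ⟨L, hL⟩ := hk
    refine ⟨L, fun x ↦ ?_⟩
    rw [edist_comm]
    simpa using hL (x * k⁻¹)

/-- The Cayley graph of a finite set is locally finite, uniformly. -/
theorem exists_card_ball_mulCayley_le (hS : S.Finite) (r : ℕ) :
    ∃ k : ℕ, ∀ v, ∃ s : Finset K, s.card ≤ k ∧ ∀ x, (mulCayley S).edist v x ≤ r → x ∈ s := by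
  classical
  -- Balls of radius `r` lie in translates of `U ^ r`; including `1` makes the powers increase.
  set U : Set K := insert 1 (S ∪ S⁻¹)
  have hU : U.Finite := (hS.union hS.inv).insert 1
  have hwalk : ∀ {v x : K} (w : (mulCayley S).Walk v x), v⁻¹ * x ∈ U ^ w.length := by
    intro v x w
    induction w with
    | nil => simp
    | @cons a b c hab w ih =>
      rw [Walk.length_cons, pow_succ']
      refine ⟨a⁻¹ * b, ?_, b⁻¹ * c, ih, by group⟩
      obtain ⟨-, g, hg, rfl | rfl⟩ := (mulCayley_adj' S a b).1 hab
      · simp [U, hg]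
      · simp [U, hg]
  have hUr : (U ^ r).Finite := by
    induction r with
    | zero => simp
    | succ r ih => rw [pow_succ]; exact ih.mul hU
  refine ⟨hUr.toFinset.card, fun v ↦ ⟨hUr.toFinset.image (v * ·), Finset.card_image_le, ?_⟩⟩
  intro x hx
  obtain ⟨w, hw⟩ := exists_walk_of_edist_ne_top (ne_top_of_le_ne_top (ENat.natCast_ne_top r) hx)
  rw [← hw, Nat.cast_le] at hx
  refine Finset.mem_image.2 ⟨v⁻¹ * x, ?_, by simp⟩
  exact hUr.mem_toFinset.2 (Set.pow_subset_pow_right (Set.mem_insert 1 _) hx (hwalk w))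

end mulCayley

end SimpleGraph

/-! ### Lamps, shifts and finite generation -/

namespace RestrictedWreathProduct

variable {G H : Type*} [Group G] [Group H]

/-- The element of the wreath product with the single lamp `a` at `h`. -/
noncomputable def lamp (h : H) (a : G) : RestrictedWreathProduct G H :=
  open scoped Classical in
  ⟨⟨Pi.mulSingle h a, 1⟩, (Set.finite_singleton h).subset Pi.mulSupport_mulSingle_subset⟩

/-- The embedding of the base of the wreath product. -/
def shift (u : H) : RestrictedWreathProduct G H :=
  ⟨⟨1, u⟩, by simp [RestrictedWreathProduct]⟩

open scoped Classical in
@[simp]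
theorem left_lamp (h : H) (a : G) : (lamp h a).1.left = Pi.mulSingle h a := rfl

@[simp]
theorem right_lamp (h : H) (a : G) : (lamp h a).1.right = 1 := rfl

@[simp]
theorem left_shift (u : H) : (shift u : RestrictedWreathProduct G H).1.left = 1 := rfl

@[simp]
theorem right_shift (u : H) : (shift u : RestrictedWreathProduct G H).1.right = u := rfl

theorem ext_left_right {x y : RestrictedWreathProduct G H} (hl : x.1.left = y.1.left)
    (hr : x.1.right = y.1.right) : x = y :=
  Subtype.ext (RegularWreathProduct.ext hl hr)

theorem shift_mul (u v : H) :
    (shift (u * v) : RestrictedWreathProduct G H) = shift u * shift v :=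
  ext_left_right (by ext; simp) (by simp)

theorem shift_one : (shift 1 : RestrictedWreathProduct G H) = 1 :=
  ext_left_right (by simp) (by simp)

theorem shift_inv (u : H) : (shift u⁻¹ : RestrictedWreathProduct G H) = (shift u)⁻¹ :=
  eq_inv_of_mul_eq_one_left (by rw [← shift_mul, inv_mul_cancel, shift_one])

theorem lamp_mul (h : H) (a b : G) : lamp h (a * b) = lamp h a * lamp h b :=
  ext_left_right (by ext; simp [Pi.mulSingle_mul]) (by simp)

theorem lamp_one (h : H) : (lamp h 1 : RestrictedWreathProduct G H) = 1 :=
  ext_left_right (by simp) (by simp)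

theorem lamp_inv (h : H) (a : G) : lamp h a⁻¹ = (lamp h a)⁻¹ :=
  eq_inv_of_mul_eq_one_left (by rw [← lamp_mul, inv_mul_cancel, lamp_one])

theorem lamp_eq_conj (h : H) (a : G) : lamp h a = shift h * lamp 1 a * shift h⁻¹ := by
  classical
  refine ext_left_right ?_ (by simp)
  ext y
  simp only [Subgroup.coe_mul, RegularWreathProduct.mul_left, left_lamp, left_shift, right_shift,
    Pi.mul_apply, Pi.one_apply, one_mul, mul_one, Pi.mulSingle_apply, inv_mul_eq_one, eq_comm]

theorem lamp_commute {h k : H} (hhk : h ≠ k) (a b : G) :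
    lamp h a * lamp k b = lamp k b * lamp h a := by
  classical
  refine ext_left_right ?_ (by simp)
  simpa using (Pi.mulSingle_commute (f := fun _ ↦ G) hhk a b).eq

theorem closure_shift_union_lamp {S : Set H} {T : Set G} (hS : Subgroup.closure S = ⊤)
    (hT : Subgroup.closure T = ⊤) :
    Subgroup.closure ((shift '' S ∪ lamp 1 '' T : Set (RestrictedWreathProduct G H))) = ⊤ := by
  classical
  set M := Subgroup.closure ((shift '' S ∪ lamp 1 '' T : Set (RestrictedWreathProduct G H)))
  have hshift : ∀ u : H, shift u ∈ M := fun u ↦ by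
    have hu : u ∈ Subgroup.closure S := hS ▸ Subgroup.mem_top u
    induction hu using Subgroup.closure_induction with
    | mem u hu => exact Subgroup.subset_closure (.inl ⟨u, hu, rfl⟩)
    | one => rw [shift_one]; exact M.one_mem
    | mul u v _ _ hu hv => rw [shift_mul]; exact M.mul_mem hu hv
    | inv u _ hu => rw [shift_inv]; exact M.inv_mem hu
  have hlamp : ∀ h : H, ∀ a : G, lamp h a ∈ M := fun h a ↦ by
    rw [lamp_eq_conj]
    refine M.mul_mem (M.mul_mem (hshift h) ?_) (hshift _)
    have ha : a ∈ Subgroup.closure T := hT ▸ Subgroup.mem_top a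
    induction ha using Subgroup.closure_induction with
    | mem a ha => exact Subgroup.subset_closure (.inr ⟨a, ha, rfl⟩)
    | one => rw [lamp_one]; exact M.one_mem
    | mul a b _ _ ha hb => rw [lamp_mul]; exact M.mul_mem ha hb
    | inv a _ ha => rw [lamp_inv]; exact M.inv_mem ha
  -- Lamps are put out one at a time by left multiplication, until a pure shift remains.
  have key : ∀ s : Finset H, ∀ x : RestrictedWreathProduct G H,
      (∀ h ∉ s, x.1.left h = 1) → x ∈ M := by
    intro s
    induction s using Finset.induction_on with
    | empty =>
      intro x hx
      have : x = shift x.1.right := ext_left_right (by ext h; simp [hx]) rfl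
      rw [this]
      exact hshift _
    | insert h s _ ih =>
      intro x hx
      have hx' : (lamp h (x.1.left h))⁻¹ * x ∈ M := by
        refine ih _ fun k hk ↦ ?_
        rw [← lamp_inv]
        rcases eq_or_ne k h with rfl | hkh
        · simp
        · simp [Pi.mulSingle_eq_of_ne hkh, hx k (by simp [hkh, hk])]
      exact (M.mul_mem_cancel_left (M.inv_mem (hlamp h _))).1 hx'
  refine (Subgroup.eq_top_iff' M).2 fun x ↦ ?_
  have hx : (Function.mulSupport x.1.left).Finite := x.2
  exact key hx.toFinset x fun h hh ↦ by simpa using hh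

instance [Group.FG G] [Group.FG H] : Group.FG (RestrictedWreathProduct G H) := by
  obtain ⟨S, hS, hSf⟩ := Group.fg_iff.1 (inferInstance : Group.FG H)
  obtain ⟨T, hT, hTf⟩ := Group.fg_iff.1 (inferInstance : Group.FG G)
  exact Group.fg_iff.2 ⟨_, closure_shift_union_lamp hS hT, (hSf.image _).union (hTf.image _)⟩

/-! ### Configurations marked along a sequence -/

/-- The elements whose lamps along the sequence `e` are: `g` at `e i`, and `1` elsewhere. -/
def lampSet (g : G) (e : ℕ → H) (i : ℕ) : Set (RestrictedWreathProduct G H) :=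
  {x | ∀ k, x.1.left (e k) = (Pi.mulSingle i g : ℕ → G) k}

theorem mul_shift_mem_lampSet {g : G} {e : ℕ → H} {i : ℕ} {x : RestrictedWreathProduct G H}
    (hx : x ∈ lampSet g e i) (u : H) : x * shift u ∈ lampSet g e i := by
  simpa [lampSet, Pi.one_apply] using hx

theorem eq_of_mem_lampSet {g : G} (hg : g ≠ 1) {e : ℕ → H} {i j : ℕ}
    {x : RestrictedWreathProduct G H} (hi : x ∈ lampSet g e i) (hj : x ∈ lampSet g e j) :
    i = j := by
  by_contra hij
  have h := (hi i).symm.trans (hj i)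
  rw [Pi.mulSingle_eq_same, Pi.mulSingle_eq_of_ne hij] at h
  exact hg h

theorem lamp_mem_lampSet (g : G) {e : ℕ → H} (he : Function.Injective e) (i : ℕ) :
    lamp (e i) g ∈ lampSet g e i := by
  intro k
  simp [Pi.mulSingle_apply, he.eq_iff]

theorem lamp_mul_lamp_mem_lampSet (g : G) {e : ℕ → H} (he : Function.Injective e) (i : ℕ)
    {h : H} (hh : ∀ k, e k ≠ h) (a : G) : lamp (e i) g * lamp h a ∈ lampSet g e i := by
  intro k
  simp [Pi.mulSingle_apply, he.eq_iff, hh k]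

section Joined

variable {Γ : SimpleGraph (RestrictedWreathProduct G H)} {L : ℕ} {S : Set H}

/-- Moving the lamplighter one generator at a time never leaves `A`; the slack `L` covers the walk
in `Γ` realising each generator. -/
theorem joinedNear_mul_shift (hS : Subgroup.closure S = ⊤)
    (hL : ∀ s ∈ S, ∀ x, Γ.edist x (x * shift s) ≤ L) {A : Set (RestrictedWreathProduct G H)}
    (hA : ∀ x ∈ A, ∀ u, x * shift u ∈ A) (u : H) :
    ∀ x ∈ A, Γ.JoinedNear L A x (x * shift u) := by
  have hu : u ∈ Subgroup.closure S := hS ▸ Subgroup.mem_top u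
  induction hu using Subgroup.closure_induction with
  | mem s hs => exact fun x hx ↦ .of_edist_le hx (hL s hs x)
  | one => exact fun x hx ↦ by simpa [shift_one] using .refl hx
  | mul u v _ _ hu hv =>
    intro x hx
    rw [shift_mul, ← mul_assoc]
    exact (hu x hx).trans (hv _ (hA x hx u))
  | inv u _ hu =>
    intro x hx
    have := (hu _ (hA x hx u⁻¹)).symm
    rwa [mul_assoc, ← shift_mul, inv_mul_cancel, shift_one, mul_one] at this

/-- Walk to `h`, switch the lamp there, walk back. -/
theorem joinedNear_mul_lamp (hS : Subgroup.closure S = ⊤)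
    (hL : ∀ s ∈ S, ∀ x, Γ.edist x (x * shift s) ≤ L) {A : Set (RestrictedWreathProduct G H)}
    (hA : ∀ x ∈ A, ∀ u, x * shift u ∈ A) {a : G} (ha : ∀ x, Γ.edist x (x * lamp 1 a) ≤ L)
    {h : H} {x : RestrictedWreathProduct G H} (hx : x ∈ A) (hxa : x * lamp h a ∈ A) :
    Γ.JoinedNear L A x (x * lamp h a) := by
  have h1 := joinedNear_mul_shift hS hL hA h x hx
  have h2 : Γ.JoinedNear L A (x * shift h) (x * shift h * lamp 1 a) :=
    .of_edist_le (hA x hx h) (ha _)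
  have h3 := joinedNear_mul_shift hS hL hA h _ hxa
  have h4 : x * lamp h a * shift h = x * shift h * lamp 1 a := by
    rw [lamp_eq_conj, shift_inv]
    group
  exact h1.trans (h2.trans (h4 ▸ h3.symm))

/-- The lamp outside the sequence `e` can be carried around without touching the lamps in `e`. -/
theorem joinedNear_lampSet (hS : Subgroup.closure S = ⊤)
    (hL : ∀ s ∈ S, ∀ x, Γ.edist x (x * shift s) ≤ L) {g : G}
    (hg : ∀ x, Γ.edist x (x * lamp 1 g) ≤ L) {e : ℕ → H} (he : Function.Injective e) (i : ℕ)
    {h h' : H} (hh : ∀ k, e k ≠ h) (hh' : ∀ k, e k ≠ h') :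
    Γ.JoinedNear L (lampSet g e i) (lamp (e i) g * lamp h g) (lamp (e i) g * lamp h' g) :=
  -- Both endpoints are joined to the configuration with the extra lamp put out.
  have key {h : H} (hh : ∀ k, e k ≠ h) :
      Γ.JoinedNear L (lampSet g e i) (lamp (e i) g) (lamp (e i) g * lamp h g) :=
    joinedNear_mul_lamp hS hL (fun _ hx ↦ mul_shift_mem_lampSet hx) hg
      (lamp_mem_lampSet g he i) (lamp_mul_lamp_mem_lampSet g he i hh g)
  (key hh).symm.trans (key hh')

end Joined

theorem exists_finset_lampSet {g : G} (hg : g ≠ 1) (e : ℕ → H)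
    (s : Finset (RestrictedWreathProduct G H)) :
    ∃ t : Finset ℕ, t.card ≤ s.card ∧ ∀ i, ∀ x ∈ lampSet g e i, x ∈ s → i ∈ t := by
  classical
  -- Each `x` has at most one index; the default `0` only enlarges the image harmlessly.
  refine ⟨s.image fun x ↦ if h : ∃ i, x ∈ lampSet g e i then h.choose else 0,
    Finset.card_image_le, fun i x hx hxs ↦ Finset.mem_image.2 ⟨x, hxs, ?_⟩⟩
  have h : ∃ i, x ∈ lampSet g e i := ⟨i, hx⟩
  rw [dif_pos h]
  exact eq_of_mem_lampSet hg h.choose_spec hx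

theorem not_isWeakCopWin_mulCayley [Group.FG H] [Nontrivial G] [Infinite H]
    {X : Set (RestrictedWreathProduct G H)} (hX : X.Finite) (hX' : Subgroup.closure X = ⊤)
    (n : ℕ) : ¬ WeakCops.IsWeakCopWin (SimpleGraph.mulCayley X) n := by
  classical
  obtain ⟨g, hg⟩ := exists_ne (1 : G)
  obtain ⟨S, hS, hSf⟩ := Group.fg_iff.1 (inferInstance : Group.FG H)
  set Γ := SimpleGraph.mulCayley X
  have hdist : ∀ k, ∃ L : ℕ, ∀ x, Γ.edist x (x * k) ≤ L := fun k ↦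
    SimpleGraph.exists_edist_mulCayley_mul_le (hX' ▸ Subgroup.mem_top k)
  choose ℓ hℓ using hdist
  set L := max (hSf.toFinset.sup fun s ↦ ℓ (shift s)) (ℓ (lamp 1 g))
  have hL : ∀ s ∈ S, ∀ x, Γ.edist x (x * shift s) ≤ L := fun s hs x ↦
    (hℓ _ x).trans <| Nat.cast_le.2 <| le_max_of_le_left <|
      Finset.le_sup (f := fun s ↦ ℓ (shift s)) (hSf.mem_toFinset.2 hs)
  have hgL : ∀ x, Γ.edist x (x * lamp 1 g) ≤ L := fun x ↦
    (hℓ _ x).trans (Nat.cast_le.2 (le_max_right _ _))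
  let ι := Infinite.natEmbedding H
  let e : ℕ → H := fun i ↦ ι (2 * i)
  let e' : ℕ → H := fun i ↦ ι (2 * i + 1)
  have he : Function.Injective e := fun i j h ↦ by
    have := ι.injective h
    omega
  have he' : Function.Injective e' := fun i j h ↦ by
    have := ι.injective h
    omega
  have hee' : ∀ i j, e i ≠ e' j := fun i j h ↦ by
    have := ι.injective h
    omega
  refine WeakCops.not_isWeakCopWin_of_joined_sets
    (fun i ↦ lamp (e i) g * lamp (e' i) g)
    (fun i ↦ {z | ∃ a ∈ lampSet g e i ∪ lampSet g e' i, Γ.edist a z ≤ L}) ?_ ?_ n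
  · intro i j
    have h1 := joinedNear_lampSet hS hL hgL he i (hee' · i) (hee' · j)
    have h2 := joinedNear_lampSet hS hL hgL he' j (fun k ↦ (hee' i k).symm)
      (fun k ↦ (hee' j k).symm)
    rw [← lamp_commute (hee' i j), ← lamp_commute (hee' j j)] at h2
    obtain ⟨w, hw⟩ := (h1.mono Set.subset_union_left).trans (h2.mono Set.subset_union_right)
    refine ⟨w, fun z hz ↦ ?_⟩
    obtain ⟨a, ha | ha, haz⟩ := hw z hz
    · exact .inl ⟨a, .inl ha, haz⟩
    · exact .inr ⟨a, .inr ha, haz⟩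
  · intro r
    -- `L` accounts for the neighbourhood, and `k + k` for the two sequences.
    obtain ⟨k, hk⟩ := SimpleGraph.exists_card_ball_mulCayley_le hX (r + L)
    refine ⟨k + k, fun v ↦ ?_⟩
    obtain ⟨s, hsk, hs⟩ := hk v
    obtain ⟨t, htc, ht⟩ := exists_finset_lampSet hg e s
    obtain ⟨t', htc', ht'⟩ := exists_finset_lampSet hg e' s
    refine ⟨t ∪ t', (Finset.card_union_le _ _).trans (by omega), ?_⟩
    rintro i x ⟨a, ha, hax⟩ hvx
    have has : a ∈ s := hs a <| by
      rw [SimpleGraph.edist_comm] at hax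
      push_cast
      exact Γ.edist_triangle.trans (add_le_add hvx hax)
    exact Finset.mem_union.2 (ha.imp (ht i a · has) (ht' i a · has))

theorem hasInfiniteWeakCopNumber (G H : Type*) [Group G] [Group H] [Group.FG G] [Group.FG H]
    [Nontrivial G] [Infinite H] :
    WeakCops.GroupHasInfiniteWeakCopNumber (RestrictedWreathProduct G H) :=
  ⟨inferInstance, fun _ hX hX' ↦ iInf₂_eq_top.2 fun n hn ↦
    absurd hn (not_isWeakCopWin_mulCayley hX hX' n)⟩

end RestrictedWreathProduct

theorem theorem1p4 :
    (∀ (G : Type*) (H : Type*) [Group G] [Group H] [Group.FG G] [Group.FG H]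
        [Nontrivial G] [Infinite H],
      WeakCops.GroupHasInfiniteWeakCopNumber (RestrictedWreathProduct G H)) ∧
    (∀ m : ℕ, 2 ≤ m →
      WeakCops.GroupHasInfiniteWeakCopNumber
        (RestrictedWreathProduct (Multiplicative (ZMod m)) (Multiplicative ℤ))) := by
  refine ⟨fun G H ↦ RestrictedWreathProduct.hasInfiniteWeakCopNumber G H, fun m hm ↦ ?_⟩
  have : NeZero m := ⟨by omega⟩
  have : Fact (1 < m) := ⟨hm⟩
  exact RestrictedWreathProduct.hasInfiniteWeakCopNumber _ _
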